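/- **Theorem.** Let $G=(V,E)$ be a finite simple graph with a unique perfect matching $M$, and let $e,f\in M$. Then $$e \prec f \iff e \to^{+} f ,$$ where $\prec$ and $\to^{+}$ are defined as follows. - A *bridge deletion ordering* of $M$ is an enumeration $M=\{(u_1,v_1),\dots,(u_n,v_n)\}$ without repetition ($|V|=2n$) such that, for every $i\in\{1,\dots,n\}$, the edge $(u_i,v_i)$ is a bridge of the induced subgraph $G[V\setminus\{u_1,v_1,\dots,u_{i-1},v_{i-1}\}]$. The *kingdom ordering* $\prec$ on $M$ is defined by: $e\prec f$ if $e$ occurs strictly before $f$ in all bridge deletion orderings of $M$. - A *blossom* for $M$ is a cycle $C$ of $G$ (without repeated vertices) such that every vertex of $C$ is matched by an edge of $M$ lying on $C$, except for exactly one vertex, the *root* of $C$. The *stem* of the blossom is the edge of $M$ incident to its root. For $e,f\in M$, write $e\to f$ ($e$ *blossom-binds* $f$) if $e$ is the stem of some blossom $C$ with $f\in M\cap C$. The relation $\to^{+}$ is the transitive closure of $\to$. -/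

import Mathlib

namespace UniquePerfectMatching

open SimpleGraph

variable {V : Type*} {G : SimpleGraph V}

/-- `M` is the unique perfect matching of `G`. -/
def IsUniquePerfectMatching (M : G.Subgraph) : Prop :=
  M.IsPerfectMatching ∧ ∀ M' : G.Subgraph, M'.IsPerfectMatching → M' = M

/-- `e` is an edge of the vertex-induced subgraph `G[S]` and is a bridge of it. -/
def IsBridgeOfInduced (G : SimpleGraph V) (S : Set V) (e : Sym2 V) : Prop :=
  ∃ e' : Sym2 S, e'.map Subtype.val = e ∧
    e' ∈ (G.induce S).edgeSet ∧ (G.induce S).IsBridge e'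

/-- The vertices that remain after the endpoints of the edges number `0, …, i - 1` of the
enumeration `σ` have been deleted. -/
def remaining {M : G.Subgraph} {n : ℕ} (σ : Fin n ≃ M.edgeSet) (i : Fin n) : Set V :=
  {v | ∀ j : Fin n, j < i → v ∉ (σ j : Sym2 V)}

/-- An enumeration of the edges of `M` is a bridge deletion ordering if each edge is a bridge of
the subgraph induced by the vertices not covered by the earlier edges. -/
def IsBridgeDeletionOrdering {M : G.Subgraph} {n : ℕ} (σ : Fin n ≃ M.edgeSet) : Prop :=
  ∀ i : Fin n, IsBridgeOfInduced G (remaining σ i) (σ i)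

/-- The kingdom ordering `e ≺ f`: the edge `e` occurs (strictly) before `f` in all bridge deletion
orderings of `M`. -/
def KingdomLT {M : G.Subgraph} (e f : M.edgeSet) : Prop :=
  ∀ (n : ℕ) (σ : Fin n ≃ M.edgeSet), IsBridgeDeletionOrdering σ → σ.symm e < σ.symm f

/-- The cycle `C` is a blossom for `M` with root `r`: every vertex of `C` other than `r` is matched
by an edge of `M` that lies on `C`, and `r` is not. -/
structure IsBlossom (M : G.Subgraph) {r : V} (C : G.Walk r r) : Prop where
  isCycle : C.IsCycle
  matched : ∀ v ∈ C.support, v ≠ r → ∃ w, M.Adj v w ∧ s(v, w) ∈ C.edges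
  root_unmatched : ∀ w, M.Adj r w → s(r, w) ∉ C.edges

/-- `e` blossom-binds `f`: the edge `e` of `M` is the stem of some blossom (it is incident to the
root), and `f` is an edge of `M` that lies on this blossom. -/
def BlossomBinds {M : G.Subgraph} (e f : M.edgeSet) : Prop :=
  ∃ (r : V) (C : G.Walk r r), IsBlossom M C ∧ r ∈ (e : Sym2 V) ∧ (f : Sym2 V) ∈ C.edges

end UniquePerfectMatching

namespace UniquePerfectMatching

open SimpleGraph

variable {V : Type*} {G : SimpleGraph V}

/-! While a blossom is intact, its own matching edges lie on a cycle and are not bridges, so the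
first deleted edge of `M` that meets it is its stem (`kingdomLT_of_blossomBinds`). Transitivity
gives one direction.

Conversely, delete bridges in `M` other than `e` as long as possible. Once `e` is the only one, all
remaining edges of `M` are bound by `e` (`transGen_of_forall_isBridge_eq`), so only such edges
follow `e` in the resulting ordering (`exists_list_bridge_deletion`).

This rests on flowers: sets grown from a root by adding ears, whose matching edges are transitively
bound by the edge at the root. A maximal flower may still have outgoing edges; following one across
a matching edge and recursing leads to a flower left only through its root edge
(`exists_isFlower_isolated`), which is therefore a bridge. If `e = ab` is the only bridge, such
flowers sit at `a` and at `b` and exhaust what remains. Uniqueness of `M` enters as the absence of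
alternating cycles. -/

/-- The vertex `v` is matched by an edge of `M` that lies on the walk `p`. -/
def CoveredBy (M : G.Subgraph) {a b : V} (p : G.Walk a b) (v : V) : Prop :=
  ∃ w, M.Adj v w ∧ s(v, w) ∈ p.edges

/-- A path all of whose vertices are matched by edges of `M` on the path. -/
structure IsCoveredPath (M : G.Subgraph) {a b : V} (p : G.Walk a b) : Prop where
  isPath : p.IsPath
  covered : ∀ v ∈ p.support, CoveredBy M p v

/-- A path all of whose vertices, except possibly the last one, are matched by edges of `M` on
the path. -/
structure IsAlmostCoveredPath (M : G.Subgraph) {a b : V} (p : G.Walk a b) : Prop where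
  isPath : p.IsPath
  covered : ∀ v ∈ p.support, v ≠ b → CoveredBy M p v

variable {M : G.Subgraph} {a b c d r r' s t v w x : V}

/-! ### Alternating paths: gluing, cutting and meeting points. -/

lemma CoveredBy.mono {p : G.Walk a b} {q : G.Walk c d} (h : CoveredBy M p v)
    (hpq : ∀ e ∈ p.edges, e ∈ q.edges) : CoveredBy M q v := by
  obtain ⟨w, hw, he⟩ := h
  exact ⟨w, hw, hpq _ he⟩

lemma isAlmostCoveredPath_nil : IsAlmostCoveredPath M (Walk.nil : G.Walk a a) :=
  ⟨Walk.IsPath.nil, by simp⟩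

lemma isPath_append_cons {p : G.Walk a b} {q : G.Walk c d} (hp : p.IsPath) (hq : q.IsPath)
    (h : G.Adj b c) (hpq : ∀ x ∈ p.support, x ∉ q.support) :
    (p.append (Walk.cons h q)).IsPath := by
  rw [Walk.isPath_def, Walk.support_append, Walk.support_cons, List.tail_cons]
  exact List.nodup_append'.2 ⟨hp.support_nodup, hq.support_nodup, fun x hx hx' => hpq x hx hx'⟩

lemma isPath_append_of_forall_eq {p : G.Walk a b} {q : G.Walk b c} (hp : p.IsPath) (hq : q.IsPath)
    (hpq : ∀ x ∈ p.support, x ∈ q.support → x = b) : (p.append q).IsPath := by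
  cases q with
  | nil => simpa using hp
  | cons h q =>
    have hq' := (Walk.cons_isPath_iff h q).1 hq
    refine isPath_append_cons hp hq'.1 h fun x hx hx' => ?_
    have := hpq x hx (by simp [hx'])
    exact hq'.2 (this ▸ hx')

lemma IsCoveredPath.reverse {p : G.Walk a b} (h : IsCoveredPath M p) :
    IsCoveredPath M p.reverse :=
  ⟨h.isPath.reverse, fun v hv => (h.covered v (by simpa using hv)).mono (by simp)⟩

lemma IsCoveredPath.ne {p : G.Walk a b} (h : IsCoveredPath M p) : a ≠ b := by
  rintro rfl
  obtain ⟨w, -, hw⟩ := h.covered a p.start_mem_support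
  rw [Walk.edges_eq_nil.2 (Walk.isPath_iff_nil.1 h.isPath)] at hw
  simp at hw

lemma IsCoveredPath.append_cons {p : G.Walk a b} {q : G.Walk c d} (hp : IsCoveredPath M p)
    (hq : IsAlmostCoveredPath M q) (h : G.Adj b c) (hpq : ∀ x ∈ p.support, x ∉ q.support) :
    IsAlmostCoveredPath M (p.append (Walk.cons h q)) := by
  refine ⟨isPath_append_cons hp.isPath hq.isPath h hpq, fun v hv hvd => ?_⟩
  rw [Walk.mem_support_append_iff, Walk.support_cons, List.mem_cons] at hv
  rcases hv with hv | rfl | hv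
  · exact (hp.covered v hv).mono (by simp +contextual [Walk.edges_append])
  · exact (hp.covered v p.end_mem_support).mono (by simp +contextual [Walk.edges_append])
  · exact (hq.covered v hv hvd).mono (by simp +contextual [Walk.edges_append])

lemma IsAlmostCoveredPath.concat {p : G.Walk a b} (hp : IsAlmostCoveredPath M p)
    (h : M.Adj b c) (hc : c ∉ p.support) : IsCoveredPath M (p.concat h.adj_sub) := by
  refine ⟨hp.isPath.concat hc _, fun v hv => ?_⟩
  rw [Walk.support_concat, List.mem_append] at hv
  by_cases hvb : v = b
  · exact ⟨c, hvb ▸ h, by simp [Walk.edges_concat, hvb]⟩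
  rcases hv with hv | hv
  · exact (hp.covered v hv hvb).mono (by simp +contextual [Walk.edges_concat])
  · obtain rfl : v = c := by simpa using hv
    exact ⟨b, h.symm, by simp [Walk.edges_concat, Sym2.eq_swap]⟩

/-- Each vertex of a covered path can be joined to one of its ends by a covered subpath. -/
lemma IsCoveredPath.exists_subpath {p : G.Walk a b} (hp : IsCoveredPath M p) (hv : v ∈ p.support) :
    (∃ q : G.Walk v b, IsCoveredPath M q ∧ q.support ⊆ p.support) ∨
      ∃ q : G.Walk v a, IsCoveredPath M q ∧ q.support ⊆ p.support := by
  obtain ⟨q₁, q₂, hq₁, hq₂, rfl⟩ := hp.isPath.mem_support_iff_exists_append.1 hv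
  -- The two halves share only `v`, so the matching edge of any other vertex lies in the same half
  -- as the vertex.
  have key : ∀ u ∈ (q₁.append q₂).support, u ≠ v →
      (u ∈ q₁.support → CoveredBy M q₁ u) ∧ (u ∈ q₂.support → CoveredBy M q₂ u) := by
    intro u hu huv
    obtain ⟨w, hw, he⟩ := hp.covered u hu
    rw [Walk.edges_append, List.mem_append] at he
    refine ⟨fun h1 => ⟨w, hw, he.resolve_right fun h2 => ?_⟩,
      fun h2 => ⟨w, hw, he.resolve_left fun h1 => ?_⟩⟩
    · exact hp.isPath.ne_of_mem_support_of_append huv h1 (q₂.fst_mem_support_of_mem_edges h2) rfl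
    · exact hp.isPath.ne_of_mem_support_of_append huv (q₁.fst_mem_support_of_mem_edges h1) h2 rfl
  obtain ⟨w, hw, he⟩ := hp.covered v hv
  rw [Walk.edges_append, List.mem_append] at he
  -- The half that contains the matching edge of `v` is the covered one.
  rcases he with he | he
  · refine Or.inr ⟨q₁.reverse, IsCoveredPath.reverse ⟨hq₁, fun u hu => ?_⟩, ?_⟩
    · by_cases huv : u = v
      · exact ⟨w, huv ▸ hw, huv ▸ he⟩
      · exact (key u (by simp [hu]) huv).1 hu
    · intro u hu
      rw [Walk.support_reverse, List.mem_reverse] at hu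
      simp [hu]
  · refine Or.inl ⟨q₂, ⟨hq₂, fun u hu => ?_⟩, fun u hu => by simp [hu]⟩
    by_cases huv : u = v
    · exact ⟨w, huv ▸ hw, huv ▸ he⟩
    · exact (key u (by simp [hu]) huv).2 hu

lemma IsAlmostCoveredPath.of_append_left {p : G.Walk a b} {q : G.Walk b c}
    (h : IsAlmostCoveredPath M (p.append q)) : IsAlmostCoveredPath M p := by
  refine ⟨h.isPath.of_append_left, fun v hv hvb => ?_⟩
  by_cases hvc : v = c
  · subst hvc
    exact absurd rfl (h.isPath.ne_of_mem_support_of_append hvb hv q.end_mem_support)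
  obtain ⟨w, hw, he⟩ := h.covered v (by simp [hv]) hvc
  rw [Walk.edges_append, List.mem_append] at he
  refine ⟨w, hw, he.resolve_right fun h2 => ?_⟩
  exact h.isPath.ne_of_mem_support_of_append hvb hv (q.fst_mem_support_of_mem_edges h2) rfl

/-- Two almost covered paths with a common end contain almost covered paths with a common end
that have no other common vertices. -/
lemma IsAlmostCoveredPath.exists_meeting {p : G.Walk s r} {q : G.Walk t r}
    (hp : IsAlmostCoveredPath M p) (hq : IsAlmostCoveredPath M q) :
    ∃ (x : V) (p' : G.Walk s x) (q' : G.Walk t x), IsAlmostCoveredPath M p' ∧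
      IsAlmostCoveredPath M q' ∧ p'.support ⊆ p.support ∧ q'.support ⊆ q.support ∧
      ∀ y ∈ p'.support, y ∈ q'.support → y = x := by
  classical
  -- `x` is the first vertex of `p` that lies on `q`.
  obtain ⟨x, hxq, hxp, hx⟩ := p.exists_mem_support_forall_mem_support_imp_eq q.support.toFinset
    ⟨r, by simp⟩
  rw [List.mem_toFinset] at hxq
  refine ⟨x, p.takeUntil x hxp, q.takeUntil x hxq, ?_, ?_, p.support_takeUntil_subset_support hxp,
    q.support_takeUntil_subset_support hxq, fun y hy hy' => hx y ?_ hy⟩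
  · exact IsAlmostCoveredPath.of_append_left (q := p.dropUntil x hxp) (by rwa [p.take_spec])
  · exact IsAlmostCoveredPath.of_append_left (q := q.dropUntil x hxq) (by rwa [q.take_spec])
  · exact List.mem_toFinset.2 (q.support_takeUntil_subset_support hxq hy')

/-! ### Uniqueness: no alternating cycles. -/

/-- A unique perfect matching admits no alternating cycle. -/
lemma IsUniquePerfectMatching.exists_not_coveredBy (hM : IsUniquePerfectMatching M)
    {C : G.Walk r r} (hC : C.IsCycle) : ∃ v ∈ C.support, ¬ CoveredBy M C v := by
  by_contra! hcov
  have halt : C.toSubgraph.spanningCoe.IsAlternating M.spanningCoe := by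
    intro v w w' hww' hvw hvw'
    simp only [Subgraph.spanningCoe_adj] at hvw hvw' ⊢
    have hv : v ∈ C.support := C.mem_verts_toSubgraph.1 (C.toSubgraph.edge_vert hvw)
    refine ⟨fun h h' => hww' (hM.1.1.eq_of_adj_left h h'), fun h => ?_⟩
    obtain ⟨u, hu, he⟩ := hcov v hv
    have he' : C.toSubgraph.Adj v u := by rwa [← Subgraph.mem_edgeSet, Walk.mem_edges_toSubgraph]
    obtain ⟨y, z, -, hyz⟩ := Set.ncard_eq_two.1 (hC.ncard_neighborSet_toSubgraph_eq_two hv)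
    have hmem : ∀ u, C.toSubgraph.Adj v u → u = y ∨ u = z := by
      intro u hu
      have : u ∈ C.toSubgraph.neighborSet v := hu
      simpa [hyz] using this
    have h1 := hmem u he'
    have h2 := hmem w hvw
    have h3 := hmem w' hvw'
    have h4 : u ≠ w' := by rintro rfl; exact h hu
    have h5 : u = w := by grind
    exact h5 ▸ hu
  -- Switching `M` along `C` yields a perfect matching without the matching edge of `r`, hence
  -- different from `M`.
  have hpm := hM.1.symmDiff_of_isAlternating halt hC.isCycles_spanningCoe_toSubgraph
  let M' : G.Subgraph :=
    { verts := Set.univ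
      Adj := (symmDiff M.spanningCoe C.toSubgraph.spanningCoe).Adj
      adj_sub := by
        intro u w h
        rw [symmDiff_def, SimpleGraph.sup_adj, SimpleGraph.sdiff_adj, SimpleGraph.sdiff_adj] at h
        rcases h with h | h
        · exact Subgraph.Adj.adj_sub h.1
        · exact Subgraph.Adj.adj_sub h.1
      edge_vert := fun _ => Set.mem_univ _
      symm := (symmDiff M.spanningCoe C.toSubgraph.spanningCoe).symm }
  have hM' : M'.IsPerfectMatching := by
    rw [Subgraph.isPerfectMatching_iff] at hpm ⊢
    simpa [M'] using hpm
  obtain ⟨w, hw, he⟩ := hcov r C.start_mem_support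
  have he' : C.toSubgraph.Adj r w := by rwa [← Subgraph.mem_edgeSet, Walk.mem_edges_toSubgraph]
  have : M'.Adj r w := by rwa [hM.2 M' hM']
  change (symmDiff M.spanningCoe C.toSubgraph.spanningCoe).Adj r w at this
  rw [symmDiff_def, SimpleGraph.sup_adj, SimpleGraph.sdiff_adj, SimpleGraph.sdiff_adj] at this
  simp [hw, he'] at this

/-- In a covered path the ends are joined by an edge of the graph only if this edge
lies on the path. -/
lemma IsUniquePerfectMatching.not_adj_of_isCoveredPath (hM : IsUniquePerfectMatching M)
    {p : G.Walk a b} (hp : IsCoveredPath M p) (h : s(b, a) ∉ p.edges) : ¬ G.Adj b a := by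
  intro hba
  obtain ⟨v, hv, hv'⟩ := hM.exists_not_coveredBy
    ((Walk.cons_isCycle_iff p hba).2 ⟨hp.isPath, h⟩)
  refine hv' ((hp.covered v ?_).mono (by simp +contextual))
  rw [Walk.support_cons, List.mem_cons] at hv
  rcases hv with rfl | hv
  · exact p.end_mem_support
  · exact hv

/-- A cycle with only one vertex that may fail to be matched on the cycle is a blossom. -/
lemma IsUniquePerfectMatching.exists_isBlossom (hM : IsUniquePerfectMatching M)
    {C : G.Walk a a} (hC : C.IsCycle) (hx : x ∈ C.support)
    (hcov : ∀ v ∈ C.support, v ≠ x → CoveredBy M C v) :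
    ∃ C' : G.Walk x x, IsBlossom M C' ∧ ∀ e ∈ C.edges, e ∈ C'.edges := by
  classical
  have hedges : ∀ e, e ∈ (C.rotate x hx).edges ↔ e ∈ C.edges :=
    fun e => (C.rotate_edges x hx).perm.mem_iff
  refine ⟨C.rotate x hx, ⟨hC.rotate hx, fun v hv hvx => ?_, fun w hw he => ?_⟩,
    fun e he => (hedges e).2 he⟩
  · exact (hcov v (by simpa using hv) hvx).mono fun e he => (hedges e).2 he
  · obtain ⟨v, hv, hv'⟩ := hM.exists_not_coveredBy hC
    by_cases hvx : v = x
    · exact hv' (hvx ▸ ⟨w, hw, (hedges _).1 he⟩)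
    · exact hv' (hcov v hv hvx)

lemma eq_of_mem_of_mem (hM : M.IsMatching) {e g : M.edgeSet} (he : v ∈ (e : Sym2 V))
    (hg : v ∈ (g : Sym2 V)) : e = g := by
  obtain ⟨e, hme⟩ := e
  obtain ⟨g, hmg⟩ := g
  obtain ⟨y, rfl⟩ := Sym2.mem_iff_exists.1 he
  obtain ⟨z, rfl⟩ := Sym2.mem_iff_exists.1 hg
  simp only [Subtype.mk.injEq]
  rw [hM.eq_of_adj_left (Subgraph.mem_edgeSet.1 hme) (Subgraph.mem_edgeSet.1 hmg)]

/-! ### Flowers and ears. -/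

/-- A set of vertices inside `X` with a root `r`, the end of the edge `s(r, r')` of the matching
that leaves the set, such that all its vertices can be joined to the root by paths which are
almost covered, and the edge at the root is related by iterated blossom-binding to the edges of
the matching inside the set. -/
structure IsFlower (M : G.Subgraph) (X : Set V) (r r' : V) (S : Set V) : Prop where
  subset : S ⊆ X
  adj : M.Adj r r'
  root_mem : r ∈ S
  notMem : r' ∉ S
  closed : ∀ v ∈ S, v ≠ r → ∀ w, M.Adj v w → w ∈ S
  exists_path : ∀ v ∈ S, ∃ p : G.Walk v r, IsAlmostCoveredPath M p ∧ ∀ x ∈ p.support, x ∈ S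
  binds : ∀ v ∈ S, v ≠ r → ∀ e g : M.edgeSet, r ∈ (e : Sym2 V) → v ∈ (g : Sym2 V) →
    Relation.TransGen BlossomBinds e g

variable {X Y S : Set V}

lemma isFlower_singleton (hr : r ∈ X) (h : M.Adj r r') : IsFlower M X r r' {r} where
  subset := by simpa using hr
  adj := h
  root_mem := rfl
  notMem := fun h' => h.ne (Set.mem_singleton_iff.1 h').symm
  closed := fun v hv hvr => absurd hv hvr
  exists_path := by
    rintro v rfl
    exact ⟨Walk.nil, isAlmostCoveredPath_nil, by simp⟩
  binds := fun v hv hvr => absurd hv hvr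

lemma IsFlower.mono (h : IsFlower M X r r' S) (hXY : X ⊆ Y) : IsFlower M Y r r' S :=
  { h with subset := h.subset.trans hXY }

/-- The edges of the matching on an ear of a flower are bound by the edge at its root. -/
lemma IsFlower.transGen_of_mem_ear (hM : IsUniquePerfectMatching M) (hS : IsFlower M X r r' S)
    {p : G.Walk a b} (hp : IsCoveredPath M p) (hpS : ∀ x ∈ p.support, x ∉ S)
    (hs : s ∈ S) (ht : t ∈ S) (has : G.Adj s a) (hbt : G.Adj b t) {e g : M.edgeSet}
    (he : r ∈ (e : Sym2 V)) (hg : (g : Sym2 V) ∈ p.edges) :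
    Relation.TransGen BlossomBinds e g := by
  obtain ⟨p₁, hp₁, hp₁S⟩ := hS.exists_path s hs
  obtain ⟨p₂, hp₂, hp₂S⟩ := hS.exists_path t ht
  -- The ear and the two paths towards the root, cut at a meeting point `x`, form a cycle covered
  -- except perhaps at `x`: a blossom rooted at `x`.
  obtain ⟨x, q₁, q₂, hq₁, hq₂, hsub₁, hsub₂, hx⟩ := hp₁.exists_meeting hp₂
  have hq₁S : ∀ y ∈ q₁.support, y ∈ S := fun y hy => hp₁S y (hsub₁ hy)
  have hq₂S : ∀ y ∈ q₂.support, y ∈ S := fun y hy => hp₂S y (hsub₂ hy)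
  have hxS : x ∈ S := hq₁S x q₁.end_mem_support
  have hq : (q₂.append q₁.reverse).IsPath := isPath_append_of_forall_eq hq₂.isPath
    hq₁.isPath.reverse fun y hy hy' => hx y (by simpa using hy') hy
  have hqS : ∀ y ∈ (q₂.append q₁.reverse).support, y ∈ S := by
    intro y hy
    rw [Walk.mem_support_append_iff, Walk.support_reverse, List.mem_reverse] at hy
    exact hy.elim (hq₂S y) (hq₁S y)
  have hL := isPath_append_cons hp.isPath hq hbt fun y hy hy' => hpS y hy (hqS y hy')
  have hsp : s ∉ p.support := fun h => hpS s h hs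
  have haS : a ∉ S := hpS a p.start_mem_support
  have hC : (Walk.cons has (p.append (Walk.cons hbt (q₂.append q₁.reverse)))).IsCycle := by
    refine (Walk.cons_isCycle_iff _ has).2 ⟨hL, fun h => ?_⟩
    rw [Walk.edges_append, Walk.edges_cons, List.mem_append, List.mem_cons] at h
    rcases h with h | h | h
    · exact hsp (p.fst_mem_support_of_mem_edges h)
    · rcases Sym2.eq_iff.1 h with ⟨h, -⟩ | ⟨-, h⟩
      · exact hsp (h ▸ p.end_mem_support)
      · exact hp.ne h
    · exact haS (hqS a (Walk.snd_mem_support_of_mem_edges _ h))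
  obtain ⟨C, hC', hCe⟩ := hM.exists_isBlossom (x := x) hC (by simp) fun v hv hvx => by
    simp only [Walk.support_cons, Walk.mem_support_append_iff, List.mem_cons,
      Walk.support_reverse, List.mem_reverse] at hv
    have hv' : v ∈ p.support ∨ v ∈ q₂.support ∨ v ∈ q₁.support := by
      rcases hv with rfl | hv | rfl | hv
      · exact Or.inr (Or.inr q₁.start_mem_support)
      · exact Or.inl hv
      · exact Or.inl p.end_mem_support
      · exact Or.inr hv
    rcases hv' with hv | hv | hv
    · exact (hp.covered v hv).mono (by simp +contextual [Walk.edges_append])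
    · exact (hq₂.covered v hv hvx).mono (by simp +contextual [Walk.edges_append])
    · exact (hq₁.covered v hv hvx).mono (by simp +contextual [Walk.edges_append])
  have hgC : (g : Sym2 V) ∈ C.edges := hCe _ (by simp [Walk.edges_append, hg])
  by_cases hxr : x = r
  · exact Relation.TransGen.single ⟨x, C, hC', hxr ▸ he, hgC⟩
  · obtain ⟨y, hy, -⟩ := hM.1.1 (hM.1.2 x)
    exact (hS.binds x hxS hxr e ⟨s(x, y), hy⟩ he (by simp)).tail ⟨x, C, hC', by simp, hgC⟩

/-- Adding an ear to a flower gives a flower. -/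
lemma IsFlower.union_ear (hM : IsUniquePerfectMatching M) (hS : IsFlower M X r r' S)
    {p : G.Walk a b} (hp : IsCoveredPath M p) (hpX : ∀ x ∈ p.support, x ∈ X)
    (hpS : ∀ x ∈ p.support, x ∉ S)
    (hs : s ∈ S) (ht : t ∈ S) (has : G.Adj s a) (hbt : G.Adj b t) :
    IsFlower M X r r' (S ∪ {x | x ∈ p.support}) where
  subset := Set.union_subset hS.subset hpX
  adj := hS.adj
  root_mem := Or.inl hS.root_mem
  notMem := by
    rintro (h | h)
    · exact hS.notMem h
    · obtain ⟨w, hw, he⟩ := hp.covered r' h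
      rw [hM.1.1.eq_of_adj_left hw hS.adj.symm] at he
      exact hpS r (p.snd_mem_support_of_mem_edges he) hS.root_mem
  closed := by
    rintro v (hv | hv) hvr w hw
    · exact Or.inl (hS.closed v hv hvr w hw)
    · obtain ⟨w', hw', he⟩ := hp.covered v hv
      rw [hM.1.1.eq_of_adj_left hw hw']
      exact Or.inr (p.snd_mem_support_of_mem_edges he)
  exists_path := by
    have key : ∀ {v c d : V} (q : G.Walk v c), IsCoveredPath M q → q.support ⊆ p.support →
        d ∈ S → G.Adj c d → ∃ p' : G.Walk v r, IsAlmostCoveredPath M p' ∧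
          ∀ x ∈ p'.support, x ∈ S ∪ {x | x ∈ p.support} := by
      intro v c d q hq hqp hd hcd
      obtain ⟨q', hq', hq'S⟩ := hS.exists_path d hd
      refine ⟨_, hq.append_cons hq' hcd fun x hx hx' => hpS x (hqp hx) (hq'S x hx'), ?_⟩
      intro x hx
      rw [Walk.mem_support_append_iff, Walk.support_cons, List.mem_cons] at hx
      rcases hx with hx | rfl | hx
      · exact Or.inr (hqp hx)
      · exact Or.inr (hqp q.end_mem_support)
      · exact Or.inl (hq'S x hx)
    rintro v (hv | hv)
    · obtain ⟨q, hq, hqS⟩ := hS.exists_path v hv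
      exact ⟨q, hq, fun x hx => Or.inl (hqS x hx)⟩
    -- An ear vertex leaves the ear at the end to which its covered subpath leads.
    · rcases hp.exists_subpath hv with ⟨q, hq, hqp⟩ | ⟨q, hq, hqp⟩
      · exact key q hq hqp ht hbt
      · exact key q hq hqp hs has.symm
  binds := by
    rintro v (hv | hv) hvr e g he hg
    · exact hS.binds v hv hvr e g he hg
    · obtain ⟨w, hw, hvw⟩ := hp.covered v hv
      have : g = ⟨s(v, w), hw⟩ := eq_of_mem_of_mem hM.1.1 hg (by simp)
      exact hS.transGen_of_mem_ear hM hp hpS hs ht has hbt he (by rwa [this])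

lemma exists_maximal_isFlower [Finite V] (hr : r ∈ X) (h : M.Adj r r') :
    ∃ S, Maximal (IsFlower M X r r') S := by
  obtain ⟨S, hS⟩ := (Set.toFinite {S | IsFlower M X r r' S}).exists_maximal
    ⟨_, isFlower_singleton hr h⟩
  exact ⟨S, hS⟩

/-! ### Isolated flowers and bridges. -/

/-- From each vertex `r` one reaches by almost covered paths a flower whose only connection with
the other vertices is the edge of the matching at its root. -/
lemma exists_isFlower_isolated [Finite V] (hM : IsUniquePerfectMatching M) (n : ℕ) :
    ∀ (X : Set V) (r r' : V), X.ncard ≤ n → M.Adj r r' → r ∈ X → r' ∉ X →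
      (∀ v ∈ X, v ≠ r → ∀ w, M.Adj v w → w ∈ X) →
      ∃ (u u' : V) (S : Set V), IsFlower M X u u' S ∧
        (∀ s ∈ S, ∃ p : G.Walk s r, IsAlmostCoveredPath M p ∧ ∀ x ∈ p.support, x ∈ X) ∧
        ∀ s ∈ S, ∀ w ∈ X, w ∉ S → G.Adj s w → s = u ∧ w = u' := by
  induction n with
  | zero =>
    intro X r r' hX _ hr
    rw [Nat.le_zero, Set.ncard_eq_zero] at hX
    simp [hX] at hr
  | succ n ih =>
    intro X r r' hX hrr' hr hr' hclosed
    obtain ⟨S, hS, hmax⟩ := exists_maximal_isFlower hr hrr'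
    by_cases hexit : ∃ s ∈ S, ∃ y ∈ X, y ∉ S ∧ G.Adj s y
    swap
    · push Not at hexit
      refine ⟨r, r', S, hS, fun s hs => ?_, fun s hs w hw hwS hsw => absurd hsw (hexit s hs w hw hwS)⟩
      obtain ⟨p, hp, hpS⟩ := hS.exists_path s hs
      exact ⟨p, hp, fun x hx => hS.subset (hpS x hx)⟩
    obtain ⟨s, hs, y, hy, hyS, hsy⟩ := hexit
    have hyr : y ≠ r := by rintro rfl; exact hyS hS.root_mem
    obtain ⟨r₁, hr₁, -⟩ := hM.1.1 (hM.1.2 y)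
    have hr₁X : r₁ ∈ X := hclosed y hy hyr r₁ hr₁
    have hr₁S : r₁ ∉ S := by
      intro h
      by_cases hr₁r : r₁ = r
      · subst hr₁r
        exact hr' (hM.1.1.eq_of_adj_left hr₁.symm hrr' ▸ hy)
      · exact hyS (hS.closed r₁ h hr₁r y hr₁.symm)
    -- Removing `S` and `y` restores the hypotheses of the induction, with `r₁` as the only vertex
    -- matched outside.
    have hsub : (X \ S) \ {y} ⊆ X := fun v hv => hv.1.1
    obtain ⟨u, u', T, hT, hTr₁, hTexit⟩ := ih ((X \ S) \ {y}) r₁ y (by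
        have : ((X \ S) \ {y}).ncard < X.ncard :=
          Set.ncard_lt_ncard ⟨hsub, fun h => (h hy).2 rfl⟩
        omega) hr₁.symm ⟨⟨hr₁X, hr₁S⟩, hr₁.ne.symm⟩ (fun h => h.2 rfl) (by
        rintro v ⟨⟨hv, hvS⟩, hvy⟩ hvr₁ w hw
        have hvr : v ≠ r := by rintro rfl; exact hvS hS.root_mem
        refine ⟨⟨hclosed v hv hvr w hw, fun hwS => ?_⟩, ?_⟩
        · by_cases hwr : w = r
          · subst hwr
            exact hr' (hM.1.1.eq_of_adj_left hw.symm hrr' ▸ hv)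
          · exact hvS (hS.closed w hwS hwr v hw.symm)
        · rintro rfl
          exact hvr₁ (hM.1.1.eq_of_adj_left hw.symm hr₁))
    have hpath : ∀ z ∈ T, ∃ p : G.Walk z y, IsCoveredPath M p ∧
        (∀ x ∈ p.support, x ∈ X ∧ x ∉ S) ∧ (z ≠ r₁ → s(y, z) ∉ p.edges) := by
      intro z hz
      obtain ⟨p, hp, hpX⟩ := hTr₁ z hz
      have hyp : y ∉ p.support := fun h => (hpX y h).2 rfl
      refine ⟨_, hp.concat hr₁.symm hyp, fun x hx => ?_, fun hzr₁ h => ?_⟩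
      · rw [Walk.support_concat, List.mem_append, List.mem_singleton] at hx
        rcases hx with hx | rfl
        · exact (hpX x hx).1
        · exact ⟨hy, hyS⟩
      · rw [Walk.edges_concat, List.concat_eq_append, List.mem_append, List.mem_singleton] at h
        rcases h with h | h
        · exact hyp (p.fst_mem_support_of_mem_edges h)
        · rcases Sym2.eq_iff.1 h with ⟨h, -⟩ | ⟨-, h⟩
          · exact hr₁.ne h
          · exact hzr₁ h
    refine ⟨u, u', T, hT.mono hsub, fun z hz => ?_, fun z hz w hw hwT hzw => ?_⟩
    · obtain ⟨p, hp, hpX, -⟩ := hpath z hz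
      obtain ⟨q, hq, hqS⟩ := hS.exists_path s hs
      refine ⟨_, hp.append_cons hq hsy.symm fun x hx hx' => (hpX x hx).2 (hqS x hx'),
        fun x hx => ?_⟩
      rw [Walk.mem_support_append_iff, Walk.support_cons, List.mem_cons] at hx
      rcases hx with hx | rfl | hx
      · exact (hpX x hx).1
      · exact hy
      · exact hS.subset (hqS x hx)
    · obtain ⟨p, hp, hpX, hpy⟩ := hpath z hz
      by_cases hwS : w ∈ S
      · have := hmax (hS.union_ear hM hp (fun x hx => (hpX x hx).1) (fun x hx => (hpX x hx).2)
          hwS hs hzw.symm hsy.symm) Set.subset_union_left (Or.inr p.end_mem_support)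
        exact absurd this hyS
      by_cases hwy : w = y
      · subst hwy
        by_cases hzr₁ : z = r₁
        · subst hzr₁
          have hzu : z = u := by
            by_contra hzu
            exact hwT (hT.closed z hz hzu w hr₁.symm)
          subst hzu
          exact ⟨rfl, hM.1.1.eq_of_adj_left hr₁.symm hT.adj⟩
        -- The edge `zy` would close an alternating cycle.
        · exact absurd hzw.symm (hM.not_adj_of_isCoveredPath hp (hpy hzr₁))
      · exact hTexit z hz w ⟨⟨hw, hwS⟩, hwy⟩ hwT hzw

lemma mem_of_reachable {H : SimpleGraph V} (hS : ∀ v ∈ S, ∀ w, H.Adj v w → w ∈ S)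
    (h : H.Reachable a b) (ha : a ∈ S) : b ∈ S := by
  rw [reachable_iff_reflTransGen] at h
  induction h with
  | refl => exact ha
  | tail _ h ih => exact hS _ ih _ h

lemma end_mem_of_support_subset (hS : ∀ v ∈ S, ∀ w ∈ Y, G.Adj v w → w ∈ S) (p : G.Walk a b)
    (hp : ∀ x ∈ p.support, x ∈ Y) (ha : a ∈ S) : b ∈ S := by
  induction p with
  | nil => exact ha
  | cons h p ih =>
    exact ih (fun x hx => hp x (by simp [hx])) (hS _ ha _ (hp _ (by simp)) h)

lemma isBridgeOfInduced_of_isolated (ha : a ∈ Y) (hb : b ∈ Y) (hab : G.Adj a b) (haS : a ∈ S)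
    (hbS : b ∉ S) (hS : ∀ v ∈ S, ∀ w ∈ Y, w ∉ S → G.Adj v w → v = a ∧ w = b) :
    IsBridgeOfInduced G Y s(a, b) := by
  refine ⟨s(⟨a, ha⟩, ⟨b, hb⟩), rfl, hab, ?_⟩
  rw [isBridge_iff]
  intro h
  refine hbS (mem_of_reachable (S := Subtype.val ⁻¹' S) ?_ h haS)
  rintro ⟨v, hv⟩ hvS ⟨w, hw⟩ hvw
  rw [deleteEdges_adj] at hvw
  by_contra hwS
  obtain ⟨rfl, rfl⟩ := hS v hvS w hw hwS hvw.1
  exact hvw.2 rfl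

lemma IsBridgeOfInduced.mem {e : Sym2 V} (h : IsBridgeOfInduced G Y e) (hv : v ∈ e) : v ∈ Y := by
  obtain ⟨e', rfl, -⟩ := h
  obtain ⟨x, -, rfl⟩ := Sym2.mem_map.1 hv
  exact x.2

/-- The isolated flower is taken in `Y \ {b}`. Restoring `b` opens no new exit except possibly the
root edge: any other edge from the flower to `b` would close an alternating cycle through `ab`. -/
lemma exists_isFlower_isBridgeOfInduced [Finite V] (hM : IsUniquePerfectMatching M)
    (hY : ∀ v ∈ Y, ∀ w, M.Adj v w → w ∈ Y) (ha : a ∈ Y) (hab : M.Adj a b) :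
    ∃ (u u' : V) (S : Set V), IsFlower M Y u u' S ∧ b ∉ S ∧ IsBridgeOfInduced G Y s(u, u') ∧
      (∀ s ∈ S, ∃ p : G.Walk s a, ∀ x ∈ p.support, x ∈ Y) ∧
      ∀ s ∈ S, ∀ w ∈ Y, w ∉ S → G.Adj s w → s = u ∧ w = u' := by
  obtain ⟨u, u', S, hS, hpath, hexit⟩ := exists_isFlower_isolated hM _ (Y \ {b}) a b le_rfl hab
    ⟨ha, hab.ne⟩ (fun h => h.2 rfl) fun v hv hva w hw => ⟨hY v hv.1 w hw, by
      rintro rfl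
      exact hva (hM.1.1.eq_of_adj_left hw.symm hab.symm)⟩
  have hSY : IsFlower M Y u u' S := hS.mono Set.sdiff_subset
  have hbS : b ∉ S := fun h => (hS.subset h).2 rfl
  have hexit' : ∀ s ∈ S, ∀ w ∈ Y, w ∉ S → G.Adj s w → s = u ∧ w = u' := by
    intro s hs w hw hwS hsw
    by_cases hwb : w = b
    · subst hwb
      obtain ⟨p, hp, hpY⟩ := hpath s hs
      have hwp : w ∉ p.support := fun h => (hpY w h).2 rfl
      by_cases hsa : s = a
      · subst hsa
        have hsu : s = u := by
          by_contra hsu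
          exact hbS (hS.closed s hs hsu w hab)
        subst hsu
        exact ⟨rfl, hM.1.1.eq_of_adj_left hab hS.adj⟩
      · refine absurd hsw.symm (hM.not_adj_of_isCoveredPath (hp.concat hab hwp) fun h => ?_)
        rw [Walk.edges_concat, List.concat_eq_append, List.mem_append, List.mem_singleton] at h
        rcases h with h | h
        · exact hwp (p.fst_mem_support_of_mem_edges h)
        · rcases Sym2.eq_iff.1 h with ⟨h, -⟩ | ⟨-, h⟩
          · exact hab.ne h.symm
          · exact hsa h
    · exact hexit s hs w ⟨hw, hwb⟩ hwS hsw
  have hu : u ∈ Y := hSY.subset hS.root_mem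
  refine ⟨u, u', S, hSY, hbS, isBridgeOfInduced_of_isolated hu (hY u hu u' hS.adj) hS.adj.adj_sub
    hS.root_mem hS.notMem hexit', fun s hs => ?_, hexit'⟩
  obtain ⟨p, -, hp⟩ := hpath s hs
  exact ⟨p, fun x hx => (hp x hx).1⟩

/-- If only one edge of the matching is a bridge, it is related to all the others by iterated
blossom-binding. -/
lemma transGen_of_forall_isBridge_eq [Finite V] (hM : IsUniquePerfectMatching M)
    (hY : ∀ v ∈ Y, ∀ w, M.Adj v w → w ∈ Y) {e g : M.edgeSet}
    (he : ∀ v ∈ (e : Sym2 V), v ∈ Y)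
    (hbridge : ∀ h : M.edgeSet, IsBridgeOfInduced G Y h → h = e)
    (hv : v ∈ (g : Sym2 V)) (hvY : v ∈ Y) (hge : g ≠ e) :
    Relation.TransGen BlossomBinds e g := by
  -- The root edge of the flower is a bridge, hence `e`; since `b ∉ S`, its root is `a`.
  have key : ∀ a b, M.Adj a b → (e : Sym2 V) = s(a, b) → ∃ S, IsFlower M Y a b S ∧
      ∀ s ∈ S, ∀ w ∈ Y, w ∉ S → G.Adj s w → s = a ∧ w = b := by
    intro a b hab heab
    obtain ⟨u, u', S, hS, hbS, hbr, -, hexit⟩ :=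
      exists_isFlower_isBridgeOfInduced hM hY (he a (by simp [heab])) hab
    have : s(u, u') = s(a, b) := by
      rw [← heab, ← hbridge ⟨s(u, u'), hS.adj⟩ hbr]
    rcases Sym2.eq_iff.1 this with ⟨rfl, rfl⟩ | ⟨rfl, rfl⟩
    · exact ⟨S, hS, hexit⟩
    · exact absurd hS.root_mem hbS
  obtain ⟨e, hme⟩ := e
  induction e with | _ a b => ?_
  have hab : M.Adj a b := hme
  obtain ⟨S, hS, hSexit⟩ := key a b hab rfl
  obtain ⟨T, hT, hTexit⟩ := key b a hab.symm Sym2.eq_swap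
  by_cases hvS : v ∈ S
  · refine hS.binds v hvS ?_ _ g (by simp) hv
    rintro rfl
    exact hge (eq_of_mem_of_mem hM.1.1 hv (by simp))
  by_cases hvT : v ∈ T
  · refine hT.binds v hvT ?_ _ g (by simp) hv
    rintro rfl
    exact hge (eq_of_mem_of_mem hM.1.1 hv (by simp))
  exfalso
  -- `S ∪ T` is a union of components of `G[Y]`. The component of `v` also contains a bridge in `M`,
  -- which must be `e`, so `v` cannot lie outside.
  have hclosed : ∀ z ∈ S ∪ T, ∀ w ∈ Y, G.Adj z w → w ∈ S ∪ T := by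
    rintro z (hz | hz) w hw hzw
    · by_contra hw'
      exact hw' (Or.inr ((hSexit z hz w hw (fun h => hw' (Or.inl h)) hzw).2 ▸ hT.root_mem))
    · by_contra hw'
      exact hw' (Or.inl ((hTexit z hz w hw (fun h => hw' (Or.inr h)) hzw).2 ▸ hS.root_mem))
  obtain ⟨v', hv', -⟩ := hM.1.1 (hM.1.2 v)
  obtain ⟨u, u', R, hR, -, hbr, hpath, -⟩ := exists_isFlower_isBridgeOfInduced hM hY hvY hv'
  have : s(u, u') = s(a, b) := congrArg Subtype.val (hbridge ⟨s(u, u'), hR.adj⟩ hbr)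
  have hu : u ∈ S ∪ T := by
    rcases Sym2.eq_iff.1 this with ⟨rfl, -⟩ | ⟨rfl, -⟩
    · exact Or.inl hS.root_mem
    · exact Or.inr hT.root_mem
  obtain ⟨p, hp⟩ := hpath u hR.root_mem
  exact (end_mem_of_support_subset hclosed p hp hu).elim hvS hvT

/-! ### Constructing the ordering. -/

/-- One can delete the edges of the matching as bridges in such an order that only those related
to `e` by iterated blossom-binding come after `e`. -/
lemma exists_list_bridge_deletion [Finite V] (hM : IsUniquePerfectMatching M) (e : M.edgeSet)
    (n : ℕ) : ∀ D : Set M.edgeSet, Dᶜ.ncard ≤ n → ∃ l : List M.edgeSet, l.Nodup ∧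
      (∀ g, g ∈ l ↔ g ∉ D) ∧
      (∀ i (hi : i < l.length), IsBridgeOfInduced G {v | (∀ g ∈ D, v ∉ (g : Sym2 V)) ∧
        ∀ j (hj : j < i), v ∉ (l[j] : Sym2 V)} l[i]) ∧
      l.Pairwise fun x y => x = e → Relation.TransGen BlossomBinds e y := by
  induction n with
  | zero =>
    intro D hD
    rw [Nat.le_zero, Set.ncard_eq_zero, Set.compl_empty_iff] at hD
    exact ⟨[], by simp [hD]⟩
  | succ n ih =>
    intro D hD
    by_cases hDu : D = Set.univ
    · exact ⟨[], by simp [hDu]⟩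
    set Y : Set V := {v | ∀ g ∈ D, v ∉ (g : Sym2 V)}
    have hY : ∀ v ∈ Y, ∀ w, M.Adj v w → w ∈ Y := by
      intro v hv w hw g hg hwg
      have : g = ⟨s(v, w), hw⟩ := eq_of_mem_of_mem hM.1.1 hwg (by simp)
      exact hv g hg (by simp [this])
    have hDY : ∀ g ∉ D, ∀ v ∈ (g : Sym2 V), v ∈ Y := fun g hg v hv g' hg' hv' =>
      hg (eq_of_mem_of_mem hM.1.1 hv hv' ▸ hg')
    -- A bridge other than `e` is preferred; `e` is deleted only when it is the sole bridge in `M`.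
    obtain ⟨g, hg, hge⟩ : ∃ g : M.edgeSet, IsBridgeOfInduced G Y g ∧
        (g = e → ∀ f ∉ D, f ≠ e → Relation.TransGen BlossomBinds e f) := by
      by_cases h : ∃ g : M.edgeSet, IsBridgeOfInduced G Y g ∧ g ≠ e
      · obtain ⟨g, hg, hge⟩ := h
        exact ⟨g, hg, fun h => absurd h hge⟩
      push Not at h
      obtain ⟨f, hf⟩ := (Set.ne_univ_iff_exists_notMem D).1 hDu
      obtain ⟨⟨a, b⟩, hab⟩ := f
      obtain ⟨u, u', S, hS, -, hbr, -⟩ := exists_isFlower_isBridgeOfInduced hM hY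
        (hDY _ hf a (Sym2.mem_mk_left a b)) hab
      have hue := h ⟨s(u, u'), hS.adj⟩ hbr
      refine ⟨⟨s(u, u'), hS.adj⟩, hbr, fun _ f hf hfe => ?_⟩
      obtain ⟨x, hx⟩ : ∃ x, x ∈ (f : Sym2 V) := ⟨_, Sym2.out_fst_mem _⟩
      refine transGen_of_forall_isBridge_eq hM hY (fun v hv => ?_) h hx (hDY f hf x hx) hfe
      rw [← hue] at hv
      exact hbr.mem hv
    have hgD : g ∉ D := fun h => hg.mem (Sym2.out_fst_mem _) g h (Sym2.out_fst_mem _)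
    obtain ⟨l, hnodup, hmem, hbr, hpw⟩ := ih (insert g D) (by
      have : (insert g D)ᶜ.ncard < Dᶜ.ncard := Set.ncard_lt_ncard
        ⟨Set.compl_subset_compl.2 (Set.subset_insert g D), fun h => h hgD (Set.mem_insert g D)⟩
      omega)
    refine ⟨g :: l, List.nodup_cons.2 ⟨by simp [hmem], hnodup⟩, fun f => ?_, fun i hi => ?_, ?_⟩
    · rw [List.mem_cons, hmem, Set.mem_insert_iff]
      by_cases hfg : f = g
      · simp [hfg, hgD]
      · simp [hfg]
    · cases i with
      | zero =>
        convert hg using 1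
        swap
        · rfl
        exact Set.ext fun v => ⟨fun h => h.1, fun h => ⟨h, fun j hj => absurd hj (by omega)⟩⟩
      | succ i =>
        convert hbr i (by simpa using hi) using 1
        swap
        · rfl
        ext v
        simp only [Set.mem_ofPred_eq, Set.mem_insert_iff, forall_eq_or_imp]
        constructor
        · rintro ⟨h, h'⟩
          exact ⟨⟨h' 0 (by omega), h⟩, fun j hj => h' (j + 1) (by omega)⟩
        · rintro ⟨⟨h, h'⟩, h''⟩
          refine ⟨h', fun j hj => ?_⟩
          cases j with
          | zero => exact h
          | succ j => exact h'' j (by omega)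
    · refine List.pairwise_cons.2 ⟨fun f hf hge' => ?_, hpw⟩
      rw [hmem, Set.mem_insert_iff, not_or] at hf
      exact hge hge' f hf.2 (hge' ▸ hf.1)

lemma transGen_of_kingdomLT [Finite V] (hM : IsUniquePerfectMatching M) {e f : M.edgeSet}
    (h : KingdomLT e f) : Relation.TransGen BlossomBinds e f := by
  classical
  obtain ⟨l, hnodup, hmem, hbr, hpw⟩ := exists_list_bridge_deletion hM e _ ∅ le_rfl
  let σ := hnodup.getEquivOfForallMemList l fun g => (hmem g).2 (Set.notMem_empty g)
  have hσ : IsBridgeDeletionOrdering σ := by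
    intro i
    convert hbr i i.2 using 1
    swap
    · rfl
    ext v
    simp only [remaining, Set.mem_ofPred_eq, Set.mem_empty_iff_false, false_imp_iff, implies_true,
      true_and]
    exact ⟨fun h j hj => h ⟨j, hj.trans i.2⟩ hj, fun h j hj => h j hj⟩
  have key := List.pairwise_iff_getElem.1 hpw _ _ (σ.symm e).2 (σ.symm f).2 (h _ σ hσ)
  have hget : ∀ g, l[(σ.symm g : ℕ)] = g := fun g => σ.apply_symm_apply g
  rw [hget, hget] at key
  exact key rfl

/-! ### Blossoms force the order. -/

lemma kingdomLT_of_blossomBinds (hM : M.IsMatching) {e f : M.edgeSet} (h : BlossomBinds e f) :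
    KingdomLT e f := by
  obtain ⟨r, C, hC, hr, hf⟩ := h
  intro n σ hσ
  by_contra! hlt
  have hex : ∃ k : ℕ, ∃ hk : k < n, ∃ v ∈ C.support, v ∈ (σ ⟨k, hk⟩ : Sym2 V) :=
    ⟨_, (σ.symm f).2, (f : Sym2 V).out.1, C.mem_support_of_mem_edges hf (Sym2.out_fst_mem _),
      by simpa using Sym2.out_fst_mem _⟩
  classical
  obtain ⟨hk, v, hv, hvσ⟩ := Nat.find_spec hex
  have hmin : ∀ j : Fin n, j < ⟨Nat.find hex, hk⟩ → ∀ v ∈ C.support, v ∉ (σ j : Sym2 V) :=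
    fun j hj v hv hvj => Nat.find_min hex hj ⟨j.2, v, hv, hvj⟩
  have hle : (⟨Nat.find hex, hk⟩ : Fin n) ≤ σ.symm f := by
    by_contra! hlt
    exact hmin _ hlt _ (C.mem_support_of_mem_edges hf (Sym2.out_fst_mem _))
      (by simpa using Sym2.out_fst_mem _)
  set i : Fin n := ⟨Nat.find hex, hk⟩
  -- `σ i` is the first edge that meets `C`. If it does so at the root, it is `e`, and `i ≤ σ.symm f
  -- ≤ σ.symm e` forces `f = e`.
  have hmem : (σ i : Sym2 V) ∈ C.edges := by
    by_cases hvr : v = r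
    · subst hvr
      have hie : σ i = e := eq_of_mem_of_mem hM hvσ hr
      have hfe : f = e := by
        rw [← hie, Equiv.symm_apply_apply] at hlt
        rw [← hie, le_antisymm hle hlt, Equiv.apply_symm_apply]
      subst hfe
      exact hie ▸ hf
    · obtain ⟨w, hw, hwC⟩ := hC.matched v hv hvr
      have : σ i = ⟨s(v, w), hw⟩ := eq_of_mem_of_mem hM hvσ (by simp)
      rwa [this]
  have hsupp : ∀ x ∈ C.support, x ∈ remaining σ i := fun x hx j hj => hmin j hj x hx
  obtain ⟨e', he', -, hbr⟩ := hσ i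
  have hcyc : (C.induce _ hsupp).IsCycle := by
    refine Walk.IsCycle.of_map (f := (Embedding.induce _).toHom) ?_
    rw [Walk.map_induce]
    exact hC.isCycle
  refine hbr.notMem_edges_of_isCycle hcyc ?_
  have h1 : (C.induce _ hsupp).edges.map (Sym2.map Subtype.val) = C.edges :=
    (Walk.edges_map _ _).symm.trans (congrArg Walk.edges (Walk.map_induce C hsupp))
  rw [← h1, ← he', List.mem_map] at hmem
  obtain ⟨e'', he'', heq⟩ := hmem
  exact Sym2.map.injective Subtype.val_injective heq ▸ he''

end UniquePerfectMatching

theorem mainTheorem1 {V : Type*} [Finite V] (G : SimpleGraph V) (M : G.Subgraph)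
    (hM : UniquePerfectMatching.IsUniquePerfectMatching M) (e f : M.edgeSet) :
    UniquePerfectMatching.KingdomLT e f ↔
      Relation.TransGen UniquePerfectMatching.BlossomBinds e f := by
  refine ⟨UniquePerfectMatching.transGen_of_kingdomLT hM, fun h => ?_⟩
  induction h with
  | single h => exact UniquePerfectMatching.kingdomLT_of_blossomBinds hM.1.1 h
  | tail _ h ih =>
    exact fun n σ hσ => (ih n σ hσ).trans
      (UniquePerfectMatching.kingdomLT_of_blossomBinds hM.1.1 h n σ hσ)
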